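/- Let $n=2k$ with $k\ge 1$, let $F,G:\mathbb{F}_{2^n}\to\mathbb{F}_{2^n}$ with $F(x)=G(x^3)$ for all $x$ and $F(0)=0$. Suppose that $F$ is quadratic, i.e. the unique polynomial $\sum_{i=0}^{2^n-1}a_ix^i$ that represents $F$ has algebraic degree $2$ (the largest number of ones in the binary expansion of an exponent $i$ with $a_i\ne 0$ is $2$), that $F$ is almost perfect nonlinear (APN), i.e. the maximum over $a\neq 0$ and $b$ of $|\{x: F(x+a)-F(x)=b\}|$ equals $2$, and that $G$ is injective on the set $C_3=\{x^3 : x\in\mathbb{F}_{2^n},\ x\ne 0\}$ of nonzero cubes. Put $D=\{F(x):x\in\mathbb{F}_{2^n}\}\setminus\{0\}$. Then $D$ is a partial difference set in the additive group of $\mathbb{F}_{2^n}$ with parameters $$\left(2^n,\ \tfrac{2^n-1}{3},\ \tfrac19(2^k+4)(2^k-2),\ \tfrac19(2^k+1)(2^k-2)\right)\quad\text{if $k$ is odd},$$ $$\left(2^n,\ \tfrac{2^n-1}{3},\ \tfrac19(2^k-4)(2^k+2),\ \tfrac19(2^k-1)(2^k+2)\right)\quad\text{if $k$ is even}.$$ Here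 a subset $D$ of a finite additive group $A$ with $0\notin D$ is a partial difference set with parameters $(v,\kappa,\lambda,\mu)$ if $|A|=v$, $|D|=\kappa$, and every nonzero $x\in A$ can be written as $x=g-h$ with $g,h\in D$, $g\neq h$, in exactly $\lambda$ ways if $x\in D$ and in exactly $\mu$ ways if $x\notin D$. -/

import Mathlib

open Polynomial

/-- The `p`-weight of `i`: the sum of the digits of `i` in base `p`. -/
def pWeight (p i : ℕ) : ℕ := (Nat.digits p i).sum

section FiniteField

variable {K : Type*} [Field K] [Fintype K]

open Classical in
/-- The polynomial `∑_{i < |K|} a_i X^i` of degree `< |K|` that represents `F : K → K`. -/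
noncomputable def reducedPoly (F : K → K) : K[X] :=
  Lagrange.interpolate Finset.univ id F

/-- The reduced polynomial has degree `< |K|` and the values of `F`, and is the only one. -/
theorem reducedPoly_spec (F : K → K) (f : K[X]) :
    f = reducedPoly F ↔ f.degree < Fintype.card K ∧ ∀ x, f.eval x = F x := by
  classical
  have h := Lagrange.eq_interpolate_iff (s := (Finset.univ : Finset K)) (v := id) (r := F)
    (f := f) (Function.injective_id.injOn)
  simp only [Finset.card_univ, Finset.mem_univ, id, forall_const] at h
  unfold reducedPoly
  convert h.symm using 2

/-- The algebraic degree of `F : K → K`, where `K` has characteristic `p`: the largest `p`-weight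
of an exponent that occurs in the reduced polynomial of `F`. -/
noncomputable def algebraicDegree (p : ℕ) (F : K → K) : ℕ :=
  (reducedPoly F).support.sup (pWeight p)

/-- `F` is quadratic if its algebraic degree is two. -/
def IsQuadratic (p : ℕ) (F : K → K) : Prop := algebraicDegree p F = 2

/-- `δ_F(a, b)`: the number of `x` with `F (x + a) - F x = b`. -/
noncomputable def differenceCount (F : K → K) (a b : K) : ℕ :=
  {x : K | F (x + a) - F x = b}.ncard

open Classical in
/-- `Δ_F`: the maximum of `δ_F(a, b)` over all `a ≠ 0` and all `b`. -/
noncomputable def differentialUniformity (F : K → K) : ℕ :=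
  (Finset.univ.filter fun ab : K × K => ab.1 ≠ 0).sup fun ab => differenceCount F ab.1 ab.2

/-- Almost perfect nonlinear functions (used over fields of characteristic two). -/
def IsAPN (F : K → K) : Prop := differentialUniformity F = 2

end FiniteField

/-- `D` is a `(v, κ, l, m)` partial difference set in the finite additive group `A`,
not containing the identity. -/
structure IsPartialDifferenceSet {A : Type*} [AddGroup A] [Finite A] (D : Set A)
    (v κ l m : ℕ) : Prop where
  card_group : Nat.card A = v
  card_set : D.ncard = κ
  zero_notMem : (0 : A) ∉ D
  count_of_mem : ∀ x ∈ D, x ≠ 0 →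
    {gh : A × A | gh.1 ∈ D ∧ gh.2 ∈ D ∧ gh.1 ≠ gh.2 ∧ gh.1 - gh.2 = x}.ncard = l
  count_of_notMem : ∀ x ∉ D, x ≠ 0 →
    {gh : A × A | gh.1 ∈ D ∧ gh.2 ∈ D ∧ gh.1 ≠ gh.2 ∧ gh.1 - gh.2 = x}.ncard = m

/-! Put q = (-2)^k = 3r + 1, so |K| = q², and let w be a primitive cube root of unity. As F(wx) =
F(x), the APN property forces F to vanish only at 0; with injectivity of G on cubes, F is
three-to-one off 0. For a ±1-valued additive character ψ, the sums W(b) = ∑ ψ(bF(x)) and S(b) = ∑_{d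
∈ D} ψ(bd) then satisfy W = 1 + 3S.

Since F is quadratic, W² = q²·|R| for a radical R stable under w, so |R| ≡ 1 mod 3
(`exists_sq_sum_addChar_eq`). As W ≡ q ≡ 1 mod 3, either W = q or |W| ≥ 2|q|, whence (S - r)(S + 2r
+ 1) ≥ 0. By the first two moments of S these products sum to 0 over b ≠ 0, so each vanishes
(`char_values_of_nonneg`). Thus S takes values in {r, -2r - 1}, and Fourier inversion gives the
difference counts (`card_mul_card_sub_eq`). -/

/-! ### Binary weight and quadratic maps -/

/-- The vanishing of all third derivatives. -/
def IsQuadraticMap {K : Type*} [CommRing K] (f : K → K) : Prop :=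
  ∀ x y z, f (x + y + z) + f x + f y + f z = f (x + y) + f (x + z) + f (y + z) + f 0

theorem exists_two_pow_of_pWeight_le_one {i : ℕ} (h : pWeight 2 i ≤ 1) :
    i = 0 ∨ ∃ a, i = 2 ^ a := by
  induction i using Nat.strong_induction_on with
  | _ i ih =>
    rcases Nat.eq_zero_or_pos i with h0 | hpos
    · exact Or.inl h0
    right
    have hd : pWeight 2 i = i % 2 + pWeight 2 (i / 2) := by
      unfold pWeight
      rw [Nat.digits_def' (by norm_num) hpos, List.sum_cons]
    rcases ih (i / 2) (by omega) (by omega) with h2 | ⟨a, ha⟩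
    · exact ⟨0, by omega⟩
    · rcases Nat.mod_two_eq_zero_or_one i with h1 | h1
      · exact ⟨a + 1, by rw [pow_succ]; omega⟩
      · have hz : pWeight 2 (i / 2) = 0 := by omega
        have hp : 0 < i / 2 := by rw [ha]; positivity
        unfold pWeight at hz
        rw [List.sum_eq_zero_iff] at hz
        have hne : Nat.digits 2 (i / 2) ≠ [] := Nat.digits_ne_nil_iff_ne_zero.2 hp.ne'
        exact absurd (hz _ (List.getLast_mem hne)) (Nat.getLast_digit_ne_zero 2 hp.ne')

theorem exists_two_pow_add_of_pWeight_le_two {i : ℕ} (h : pWeight 2 i ≤ 2) :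
    i = 0 ∨ (∃ a, i = 2 ^ a) ∨ ∃ a b, i = 2 ^ a + 2 ^ b := by
  induction i using Nat.strong_induction_on with
  | _ i ih =>
    rcases Nat.eq_zero_or_pos i with h0 | hpos
    · exact Or.inl h0
    right
    have hd : pWeight 2 i = i % 2 + pWeight 2 (i / 2) := by
      unfold pWeight
      rw [Nat.digits_def' (by norm_num) hpos, List.sum_cons]
    rcases Nat.mod_two_eq_zero_or_one i with h1 | h1
    · rcases ih (i / 2) (by omega) (by omega) with h2 | ⟨a, ha⟩ | ⟨a, b, hab⟩
      · omega
      · exact Or.inl ⟨a + 1, by rw [pow_succ]; omega⟩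
      · exact Or.inr ⟨a + 1, b + 1, by rw [pow_succ, pow_succ]; omega⟩
    · rcases exists_two_pow_of_pWeight_le_one (i := i / 2) (by omega) with h2 | ⟨a, ha⟩
      · exact Or.inl ⟨0, by omega⟩
      · exact Or.inr ⟨0, a + 1, by rw [pow_succ, pow_zero]; omega⟩

/-- The exponent is 0, 2^a or 2^a + 2^b, so by additivity of Frobenius the power is constant,
additive or a product of two additive maps. -/
theorem isQuadraticMap_pow_of_pWeight_le_two {K : Type*} [CommRing K] [CharP K 2] {i : ℕ}
    (h : pWeight 2 i ≤ 2) : IsQuadraticMap fun x : K => x ^ i := by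
  intro x y z
  have h2 : (2 : K) = 0 := CharTwo.two_eq_zero
  rcases exists_two_pow_add_of_pWeight_le_two h with rfl | ⟨a, rfl⟩ | ⟨a, b, rfl⟩
  · simp
  · have h0 : (0 : K) ^ 2 ^ a = 0 := zero_pow (by positivity)
    simp only [add_pow_char_pow, h0]
    ring
  · have h0 : (0 : K) ^ 2 ^ a = 0 := zero_pow (by positivity)
    simp only [pow_add, add_pow_char_pow, h0]
    ring

theorem IsQuadratic.isQuadraticMap {K : Type*} [Field K] [Fintype K] [CharP K 2] {F : K → K}
    (h : IsQuadratic 2 F) : IsQuadraticMap F := by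
  have hev := ((reducedPoly_spec F _).1 rfl).2
  have hF : F = fun x => ∑ i ∈ (reducedPoly F).support, (reducedPoly F).coeff i * x ^ i := by
    funext x
    rw [← hev x, eval_eq_sum, Polynomial.sum]
  rw [hF]
  intro x y z
  simp only [← Finset.sum_add_distrib]
  refine Finset.sum_congr rfl fun i hi => ?_
  have hi2 : pWeight 2 i ≤ 2 := by
    have := Finset.le_sup (f := pWeight 2) hi
    unfold IsQuadratic algebraicDegree at h
    omega
  have := isQuadraticMap_pow_of_pWeight_le_two (K := K) hi2 x y z
  simp only at this
  linear_combination (reducedPoly F).coeff i * this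

/-! ### Integer-valued characters and their moments -/

/-- The character is (-1)^Tr. Values in ℤ make congruences mod 3 and inequalities available for the
character sums. -/
theorem exists_primitive_addChar_int (K : Type*) [Field K] [Fintype K] [CharP K 2] :
    ∃ ψ : AddChar K ℤ, ψ.IsPrimitive := by
  let _ : Algebra (ZMod 2) K := ZMod.algebra K 2
  let ψ₀ : AddChar (ZMod 2) ℤ := AddChar.zmodChar 2 (ζ := -1) (by norm_num)
  refine ⟨ψ₀.compAddMonoidHom (Algebra.trace (ZMod 2) K).toAddMonoidHom, ?_⟩
  apply AddChar.IsPrimitive.of_ne_one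
  obtain ⟨a, h1⟩ := Algebra.trace_surjective (ZMod 2) K 1
  refine AddChar.ne_one_iff.2 ⟨a, ?_⟩
  simp only [AddChar.compAddMonoidHom_apply, LinearMap.toAddMonoidHom_coe]
  rw [h1, AddChar.zmodChar_apply]
  decide

theorem AddChar.map_mul_self_of_charTwo {K : Type*} [CommRing K] [CharP K 2] (ψ : AddChar K ℤ)
    (x : K) : ψ x * ψ x = 1 := by
  rw [← AddChar.map_add_eq_mul, CharTwo.add_self_eq_zero, AddChar.map_zero_eq_one]

section CharacterSums

variable {K : Type*} [Field K] [Fintype K] [DecidableEq K] [CharP K 2] {ψ : AddChar K ℤ}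

theorem sum_addChar_sum (hψ : ψ.IsPrimitive) (D : Finset K) (x : K) :
    ∑ b, ψ (x * b) * ∑ d ∈ D, ψ (d * b) = if x ∈ D then (Fintype.card K : ℤ) else 0 := by
  simp only [Finset.mul_sum, ← AddChar.map_add_eq_mul, ← add_mul]
  rw [Finset.sum_comm]
  have h (d : K) : ∑ b, ψ ((x + d) * b) = if x = d then (Fintype.card K : ℤ) else 0 := by
    simp only [mul_comm (x + d), AddChar.sum_mulShift _ hψ, CharTwo.add_eq_zero]
    split_ifs <;> simp
  simp only [h, Finset.sum_ite_eq]

theorem sum_addChar_sum_sq (hψ : ψ.IsPrimitive) (D : Finset K) (x : K) :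
    ∑ b, ψ (x * b) * (∑ d ∈ D, ψ (d * b)) ^ 2 =
      Fintype.card K * ((D ×ˢ D).filter fun p => p.1 - p.2 = x).card := by
  have h (b : K) : ψ (x * b) * (∑ d ∈ D, ψ (d * b)) ^ 2 =
      ∑ g ∈ D, ψ ((x + g) * b) * ∑ d ∈ D, ψ (d * b) := by
    simp only [add_mul, AddChar.map_add_eq_mul]
    rw [← Finset.sum_mul, ← Finset.mul_sum]
    ring
  simp only [h]
  rw [Finset.sum_comm]
  simp only [sum_addChar_sum hψ]
  rw [← Finset.sum_filter, Finset.sum_const, nsmul_eq_mul, mul_comm]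
  congr 2
  refine Finset.card_bij (fun g _ => (x + g, g)) ?_ ?_ ?_
  · intro g hg
    simp only [Finset.mem_filter, Finset.mem_product] at hg ⊢
    exact ⟨⟨hg.2, hg.1⟩, by ring⟩
  · intro g _ g' _ h
    exact (Prod.ext_iff.1 h).2
  · rintro ⟨g, g'⟩ hg
    simp only [Finset.mem_filter, Finset.mem_product] at hg
    obtain ⟨⟨h1, h2⟩, rfl⟩ := hg
    exact ⟨g', by simpa using ⟨h2, h1⟩, by simp⟩

/-- Used twice: x = 0 gives the moment balance that forces two values, x ≠ 0 gives the difference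
counts. -/
theorem sum_addChar_quadratic (hψ : ψ.IsPrimitive) (D : Finset K) (r s : ℤ) (x : K) :
    ∑ b, ψ (x * b) * ((∑ d ∈ D, ψ (d * b) - r) * (∑ d ∈ D, ψ (d * b) - s)) =
      Fintype.card K * (((D ×ˢ D).filter fun p => p.1 - p.2 = x).card
        - (r + s) * (if x ∈ D then 1 else 0) + r * s * (if x = 0 then 1 else 0)) := by
  have h1 := sum_addChar_sum_sq hψ D x
  have h2 := sum_addChar_sum hψ D x
  have h3 : ∑ b, ψ (x * b) = if x = 0 then (Fintype.card K : ℤ) else 0 := by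
    simp only [mul_comm x, AddChar.sum_mulShift _ hψ]
    split_ifs <;> simp
  have h (b : K) : ψ (x * b) * ((∑ d ∈ D, ψ (d * b) - r) * (∑ d ∈ D, ψ (d * b) - s)) =
      ψ (x * b) * (∑ d ∈ D, ψ (d * b)) ^ 2 - (r + s) * (ψ (x * b) * ∑ d ∈ D, ψ (d * b))
        + r * s * ψ (x * b) := by ring
  simp only [h, Finset.sum_add_distrib, Finset.sum_sub_distrib, ← Finset.mul_sum, h1, h2, h3]
  split_ifs <;> ring

/-- Fourier inversion for a set all of whose nontrivial character values lie in `{r, s}`. -/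
theorem card_mul_card_sub_eq (hψ : ψ.IsPrimitive) (D : Finset K) {r s : ℤ}
    (hD : ∀ b ≠ 0, (∑ d ∈ D, ψ (d * b) - r) * (∑ d ∈ D, ψ (d * b) - s) = 0)
    {x : K} (hx : x ≠ 0) :
    (Fintype.card K : ℤ) * (((D ×ˢ D).filter fun p => p.1 - p.2 = x).card
      - (r + s) * (if x ∈ D then 1 else 0)) = (D.card - r) * (D.card - s) := by
  have h := sum_addChar_quadratic hψ D r s x
  rw [Finset.sum_eq_single 0 (fun b _ hb => by rw [hD b hb, mul_zero]) (by simp)] at h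
  simp only [mul_zero, AddChar.map_zero_eq_one, Finset.sum_const, hx, if_false, add_zero,
    nsmul_eq_mul, mul_one, one_mul] at h
  exact h.symm

/-- If `(S - r) (S - s) ≥ 0` for all nontrivial character values `S` and the first two moments
balance, all these values lie in `{r, s}`. -/
theorem char_values_of_nonneg (hψ : ψ.IsPrimitive) (D : Finset K) (h0 : (0 : K) ∉ D) {r s : ℤ}
    (hD : ∀ b ≠ 0, 0 ≤ (∑ d ∈ D, ψ (d * b) - r) * (∑ d ∈ D, ψ (d * b) - s))
    (hm : (Fintype.card K : ℤ) * (D.card + r * s) = (D.card - r) * (D.card - s)) :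
    ∀ b ≠ 0, (∑ d ∈ D, ψ (d * b) - r) * (∑ d ∈ D, ψ (d * b) - s) = 0 := by
  have h := sum_addChar_quadratic hψ D r s 0
  have hc : ((D ×ˢ D).filter fun p => p.1 - p.2 = 0).card = D.card := by
    refine Finset.card_bij (fun p _ => p.1) ?_ ?_ ?_
    · intro p hp
      simp only [Finset.mem_filter, Finset.mem_product] at hp
      exact hp.1.1
    · intro p hp p' hp' h
      simp only [Finset.mem_filter, Finset.mem_product, sub_eq_zero] at hp hp'
      exact Prod.ext h (by rw [← hp.2, ← hp'.2, h])
    · intro d hd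
      exact ⟨(d, d), by simp [hd], rfl⟩
  rw [hc, ← Finset.add_sum_erase _ _ (Finset.mem_univ 0)] at h
  simp only [mul_zero, zero_mul, AddChar.map_zero_eq_one, Finset.sum_const, h0, if_false, if_true,
    nsmul_eq_mul, mul_one, one_mul, sub_zero] at h
  -- By `hm`, the term b = 0 already equals the whole sum.
  have hz : ∑ b ∈ Finset.univ.erase (0 : K),
      (∑ d ∈ D, ψ (d * b) - r) * (∑ d ∈ D, ψ (d * b) - s) = 0 := by linarith
  rw [Finset.sum_eq_zero_iff_of_nonneg fun b hb => hD b (Finset.ne_of_mem_erase hb)] at hz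
  exact fun b hb => hz b (Finset.mem_erase.2 ⟨hb, Finset.mem_univ b⟩)

end CharacterSums

/-! ### Cube roots of unity and fibres of cubing -/

section CubeRoots

variable {K : Type*} [Field K] {w : K}

theorem exists_primitive_cube_root [Fintype K] (h3 : 3 ∣ Fintype.card K - 1) :
    ∃ w : K, w ^ 2 + w + 1 = 0 ∧ w ≠ 1 := by
  classical
  have : Fact (Nat.Prime 3) := ⟨Nat.prime_three⟩
  rw [← Fintype.card_units] at h3
  obtain ⟨u, hu⟩ := exists_prime_orderOf_dvd_card 3 h3
  have h1 : (u : K) ≠ 1 := by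
    intro h
    rw [Units.val_eq_one] at h
    rw [h, orderOf_one] at hu
    omega
  have hp : (u : K) ^ 3 = 1 := by
    rw [← Units.val_pow_eq_pow_val, ← hu, pow_orderOf_eq_one, Units.val_one]
  refine ⟨u, mul_left_cancel₀ (sub_ne_zero.2 h1) ?_, h1⟩
  linear_combination hp

theorem cube_eq_one_of_sq_add (hw : w ^ 2 + w + 1 = 0) : w ^ 3 = 1 := by
  linear_combination (w - 1) * hw

theorem pow_three_eq_iff (hw : w ^ 2 + w + 1 = 0) (x y : K) :
    y ^ 3 = x ^ 3 ↔ y = x ∨ y = w * x ∨ y = w ^ 2 * x := by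
  have h3 := cube_eq_one_of_sq_add hw
  constructor
  · intro h
    have : (y - x) * ((y - w * x) * (y - w ^ 2 * x)) = 0 := by
      linear_combination h + (y * x ^ 2 - x * y ^ 2) * hw + (x ^ 2 * y - x ^ 3) * h3
    simpa [sub_eq_zero] using this
  · rintro (rfl | rfl | rfl)
    · rfl
    · rw [mul_pow, h3, one_mul]
    · rw [mul_pow, ← pow_mul, mul_comm 2 3, pow_mul, h3, one_pow, one_mul]

theorem card_cube_orbit [DecidableEq K] (hw : w ^ 2 + w + 1 = 0) (hw1 : w ≠ 1) {x : K}
    (hx : x ≠ 0) : ({x, w * x, w ^ 2 * x} : Finset K).card = 3 := by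
  have hw0 : w ≠ 0 := by rintro rfl; simp at hw
  refine Finset.card_eq_three.2 ⟨_, _, _, ?_, ?_, ?_, rfl⟩
  · intro h
    exact hw1 (mul_right_cancel₀ hx (by rw [← h, one_mul]))
  · intro h
    have h2 : w ^ 2 = 1 := mul_right_cancel₀ hx (by rw [← h, one_mul])
    have h3 := cube_eq_one_of_sq_add hw
    rw [pow_succ, h2, one_mul] at h3
    exact hw1 h3
  · intro h
    have h2 : w = w ^ 2 := mul_right_cancel₀ hx h
    exact hw1 (mul_left_cancel₀ hw0 (by rw [mul_one, ← sq, ← h2]))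

/-- A set of nonzero elements that is stable under a primitive cube root of unity has a
cardinality divisible by three. -/
theorem three_dvd_card_of_mul_mem [DecidableEq K] (hw : w ^ 2 + w + 1 = 0) (hw1 : w ≠ 1)
    (s : Finset K) (h0 : (0 : K) ∉ s) (hs : ∀ x ∈ s, w * x ∈ s) : 3 ∣ s.card := by
  rw [Finset.card_eq_sum_card_image (fun x => x ^ 3) s]
  refine Finset.dvd_sum fun c hc => ?_
  obtain ⟨x, hx, rfl⟩ := Finset.mem_image.1 hc
  have : s.filter (fun y => y ^ 3 = x ^ 3) = {x, w * x, w ^ 2 * x} := by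
    ext y
    simp only [Finset.mem_filter, Finset.mem_insert, Finset.mem_singleton, pow_three_eq_iff hw]
    refine ⟨fun h => h.2, fun h => ⟨?_, h⟩⟩
    rcases h with rfl | rfl | rfl
    · exact hx
    · exact hs _ hx
    · rw [sq, mul_assoc]; exact hs _ (hs _ hx)
  rw [this, card_cube_orbit hw hw1 (fun h => h0 (h ▸ hx))]

end CubeRoots

/-! ### Character sums of three-to-one quadratic maps -/

section ThreeToOne

variable {K : Type*} [Field K] [Fintype K] [DecidableEq K] {F : K → K} {w : K}

theorem sum_comp_eq_of_three_to_one (hw : w ^ 2 + w + 1 = 0) (hw1 : w ≠ 1)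
    (hF : ∀ x y, F x = F y ↔ x ^ 3 = y ^ 3) (hF0 : F 0 = 0) (g : K → ℤ) :
    ∑ x, g (F x) = g 0 + 3 * ∑ d ∈ (Finset.univ.image F).erase 0, g d := by
  have h0 : (0 : K) ∈ Finset.univ.image F := Finset.mem_image.2 ⟨0, Finset.mem_univ _, hF0⟩
  rw [← Finset.sum_fiberwise_of_maps_to (g := F) (t := Finset.univ.image F)
    (fun x hx => Finset.mem_image_of_mem F hx), ← Finset.add_sum_erase _ _ h0, Finset.mul_sum]
  congr 1
  · have : Finset.univ.filter (fun x => F x = 0) = {0} := by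
      ext x
      simp only [Finset.mem_filter, Finset.mem_univ, true_and, Finset.mem_singleton]
      nth_rewrite 1 [← hF0]
      rw [hF]
      simp
    rw [this, Finset.sum_singleton, hF0]
  · refine Finset.sum_congr rfl fun d hd => ?_
    obtain ⟨hd0, hd⟩ := Finset.mem_erase.1 hd
    obtain ⟨x, -, rfl⟩ := Finset.mem_image.1 hd
    have hx : x ≠ 0 := by rintro rfl; exact hd0 hF0
    have : Finset.univ.filter (fun y => F y = F x) = {x, w * x, w ^ 2 * x} := by
      ext y
      simp [hF, pow_three_eq_iff hw]
    rw [Finset.sum_congr rfl (g := fun _ => g (F x)) fun y hy => by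
      rw [(Finset.mem_filter.1 hy).2], Finset.sum_const, this, card_cube_orbit hw hw1 hx]
    simp

/-- The squared character sum of a quadratic map that factors through the cubing map. -/
theorem exists_sq_sum_addChar_eq [CharP K 2] {ψ : AddChar K ℤ} (hw : w ^ 2 + w + 1 = 0)
    (hw1 : w ≠ 1) (hq : IsQuadraticMap F) (hFw : ∀ x, F (w * x) = F x) (hF0 : F 0 = 0) (b : K) :
    ∃ m : ℕ, (∑ x, ψ (F x * b)) ^ 2 = Fintype.card K * (3 * m + 1 : ℤ) := by
  have h3 := cube_eq_one_of_sq_add hw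
  have hw0 : w ≠ 0 := by rintro rfl; simp at hw
  let B : K → K → K := fun y x => F (x + y) + F x + F y
  have hB (y : K) : ∀ x z, B y (x + z) = B y x + B y z := by
    intro x z
    have := hq x z y
    rw [hF0] at this
    have h2 : (2 : K) = 0 := CharTwo.two_eq_zero
    simp only [B]
    linear_combination this - (F x + F z + F y - F (x + z)) * h2
  let χ : K → AddChar K ℤ := fun y =>
    { toFun := fun x => ψ (B y x * b)
      map_zero_eq_one' := by
        have := hB y 0 0
        rw [add_zero, left_eq_add] at this
        rw [this, zero_mul, AddChar.map_zero_eq_one]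
      map_add_eq_mul' := fun x z => by rw [hB, add_mul, AddChar.map_add_eq_mul] }
  have hχ (y x : K) : χ y x = ψ (B y x * b) := rfl
  -- Invariance of F under w gives B(wy, x) = B(y, w²x).
  have hχw (y : K) : χ y = 0 → χ (w * y) = 0 := by
    intro h
    rw [AddChar.eq_zero_iff] at h ⊢
    intro x
    rw [← h (w ^ 2 * x), hχ, hχ]
    have e1 : F (x + w * y) = F (w ^ 2 * x + y) := by
      rw [← hFw (w ^ 2 * x + y)]
      congr 1
      linear_combination (-x) * h3
    have e2 : F (w ^ 2 * x) = F x := by rw [sq, mul_assoc, hFw, hFw]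
    simp only [B, e1, e2, hFw]
  let R : Finset K := Finset.univ.filter fun y => χ y = 0
  have hR0 : (0 : K) ∈ R := by
    simp only [R, Finset.mem_filter, Finset.mem_univ, true_and, AddChar.eq_zero_iff, hχ, B]
    intro x
    simp [hF0, CharTwo.add_self_eq_zero]
  have hR3 : 3 ∣ (R.erase 0).card := by
    refine three_dvd_card_of_mul_mem hw hw1 _ (Finset.notMem_erase _ _) fun y hy => ?_
    simp only [R, Finset.mem_erase, Finset.mem_filter, Finset.mem_univ, true_and] at hy ⊢
    exact ⟨mul_ne_zero hw0 hy.1, hχw y hy.2⟩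
  -- Evaluate at x = wy: since wy + y = w²y, B(y, wy) = 3F(y) = F(y).
  have hRψ : ∀ y ∈ R, ψ (F y * b) = 1 := by
    intro y hy
    have h := (Finset.mem_filter.1 hy).2
    rw [AddChar.eq_zero_iff] at h
    rw [← h (w * y), hχ]
    have e : F (w * y + y) = F y := by
      have h2 : (2 : K) = 0 := CharTwo.two_eq_zero
      have : w * y + y = w * (w * y) := by
        linear_combination (w * y + y) * h2 - y * hw
      rw [this, hFw, hFw]
    simp only [B, e, hFw, CharTwo.add_self_eq_zero, zero_add]
  have hRc : R.card = (R.erase 0).card + 1 := (Finset.card_erase_add_one hR0).symm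
  obtain ⟨m, hm⟩ := hR3
  refine ⟨m, ?_⟩
  -- Square the sum and shift the second variable by the first; the inner sum over x then vanishes
  -- unless y lies in the radical.
  have key : (∑ x, ψ (F x * b)) ^ 2 = ∑ y, ψ (F y * b) * ∑ x, χ y x := by
    rw [sq, Finset.sum_mul_sum]
    have : ∀ x ∈ (Finset.univ : Finset K), ∑ y, ψ (F x * b) * ψ (F y * b) =
        ∑ y, ψ (F x * b) * ψ (F (x + y) * b) := fun x _ =>
      (Equiv.sum_comp (Equiv.addLeft x) fun y => ψ (F x * b) * ψ (F y * b)).symm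
    rw [Finset.sum_congr rfl this, Finset.sum_comm]
    refine Finset.sum_congr rfl fun y _ => ?_
    rw [Finset.mul_sum]
    refine Finset.sum_congr rfl fun x _ => ?_
    simp only [hχ, B, add_mul, AddChar.map_add_eq_mul]
    linear_combination (-(ψ (F x * b) * ψ (F (x + y) * b))) *
      AddChar.map_mul_self_of_charTwo ψ (F y * b)
  rw [key]
  simp only [AddChar.sum_eq_ite, mul_ite, mul_zero]
  rw [← Finset.sum_filter, Finset.sum_congr rfl (g := fun _ => (Fintype.card K : ℤ))
    fun y hy => by rw [hRψ y hy, one_mul], Finset.sum_const, nsmul_eq_mul, mul_comm]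
  congr 1
  change (R.card : ℤ) = _
  rw [hRc, hm]
  push_cast
  ring

end ThreeToOne

/-! ### APN property and the two character values -/

theorem IsAPN.differenceCount_le {K : Type*} [Field K] [Fintype K] {F : K → K} (h : IsAPN F)
    {a : K} (ha : a ≠ 0) (b : K) : differenceCount F a b ≤ 2 := by
  classical
  unfold IsAPN differentialUniformity at h
  rw [← h]
  exact Finset.le_sup (f := fun ab : K × K => differenceCount F ab.1 ab.2)
    (b := (a, b)) (by simpa using ha)

/-- An APN map that factors through the cubing map vanishes only where it has to. -/
theorem IsAPN.ne_zero_of_cube {K : Type*} [Field K] [Fintype K] [CharP K 2] {F : K → K} {w : K}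
    (hw : w ^ 2 + w + 1 = 0) (hw1 : w ≠ 1) (h : IsAPN F) (hFw : ∀ x, F (w * x) = F x)
    (hF0 : F 0 = 0) {x : K} (hx : x ≠ 0) : F x ≠ 0 := by
  classical
  intro hFx
  have h2 : (2 : K) = 0 := CharTwo.two_eq_zero
  have hw0 : w ≠ 0 := by rintro rfl; simp at hw
  have hle := h.differenceCount_le hx 0
  -- If F(x) = 0, the equation F(y + x) = F(y) has three solutions 0, x, wx, because wx + x = w²x.
  have hsub : (({0, x, w * x} : Finset K) : Set K) ⊆ {y : K | F (y + x) - F y = 0} := by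
    intro y hy
    simp only [Finset.coe_insert, Finset.coe_singleton, Set.mem_insert_iff,
      Set.mem_singleton_iff] at hy
    simp only [Set.mem_ofPred_eq]
    rcases hy with rfl | rfl | rfl
    · rw [zero_add, hFx, hF0, sub_zero]
    · rw [CharTwo.add_self_eq_zero, hFx, hF0, sub_zero]
    · have : w * x + x = w * (w * x) := by linear_combination (w * x + x) * h2 - x * hw
      rw [this, hFw, hFw, sub_self]
  have hcard : ({0, x, w * x} : Finset K).card = 3 := by
    refine Finset.card_eq_three.2 ⟨_, _, _, hx.symm, (mul_ne_zero hw0 hx).symm, ?_, rfl⟩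
    intro h
    exact hw1 (mul_right_cancel₀ hx (by rw [← h, one_mul]))
  have := Set.ncard_le_ncard hsub (Set.toFinite _)
  rw [Set.ncard_coe_finset, hcard] at this
  unfold differenceCount at hle
  omega

/-- For m = 0 the residue mod 3 excludes W = -q; for m ≥ 1, |W| ≥ 2|q|. The integer q may be
negative. -/
theorem nonneg_of_sq_eq_mul {q W : ℤ} {m : ℕ} (hq : q % 3 = 1) (hW : W % 3 = 1)
    (h : W ^ 2 = q ^ 2 * (3 * m + 1)) : 0 ≤ (W - q) * (W + 2 * q) := by
  rcases Nat.eq_zero_or_pos m with rfl | hm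
  · rw [Nat.cast_zero, mul_zero, zero_add, mul_one, sq_eq_sq_iff_eq_or_eq_neg] at h
    rcases h with rfl | rfl
    · simp
    · omega
  · have hm' : (1 : ℤ) ≤ m := by exact_mod_cast hm
    have h4 : 4 * q ^ 2 ≤ W ^ 2 := by rw [h]; nlinarith [sq_nonneg q]
    nlinarith [sq_nonneg (W + 2 * q)]

theorem charSum_mem_of_cube {K : Type*} [Field K] [Fintype K] [DecidableEq K] [CharP K 2]
    {ψ : AddChar K ℤ} (hψ : ψ.IsPrimitive) {F : K → K} {w : K} (hw : w ^ 2 + w + 1 = 0)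
    (hw1 : w ≠ 1) (hq : IsQuadraticMap F) (hF : ∀ x y, F x = F y ↔ x ^ 3 = y ^ 3)
    (hF0 : F 0 = 0) {r : ℤ} (hK : (Fintype.card K : ℤ) = (3 * r + 1) ^ 2) :
    (((Finset.univ.image F).erase 0).card : ℤ) = 3 * r ^ 2 + 2 * r ∧
    ∀ b ≠ 0, (∑ d ∈ (Finset.univ.image F).erase 0, ψ (d * b) - r) *
      (∑ d ∈ (Finset.univ.image F).erase 0, ψ (d * b) - (-2 * r - 1)) = 0 := by
  have hsum := sum_comp_eq_of_three_to_one hw hw1 hF hF0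
  have hcard : (((Finset.univ.image F).erase 0).card : ℤ) = 3 * r ^ 2 + 2 * r := by
    have := hsum fun _ => 1
    simp only [Finset.sum_const, Finset.card_univ, nsmul_eq_mul, mul_one] at this
    linarith
  refine ⟨hcard, char_values_of_nonneg hψ _ (Finset.notMem_erase _ _) ?_ ?_⟩
  · intro b _
    have hFw : ∀ x, F (w * x) = F x := fun x => (hF _ _).2 (by
      rw [mul_pow, cube_eq_one_of_sq_add hw, one_mul])
    obtain ⟨m, hm⟩ := exists_sq_sum_addChar_eq (ψ := ψ) hw hw1 hq hFw hF0 b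
    have hs := hsum fun x => ψ (x * b)
    rw [zero_mul, AddChar.map_zero_eq_one] at hs
    rw [hs, hK] at hm
    have := nonneg_of_sq_eq_mul (by omega) (by omega) hm
    -- With W = 1 + 3S and q = 3r + 1, the factors W - q and W + 2q are 3(S - r) and 3(S + 2r + 1).
    nlinarith
  · rw [hcard, hK]
    ring

/-- The difference counts of the nonzero image of a quadratic three-to-one map. -/
theorem card_sub_eq_of_cube {K : Type*} [Field K] [Fintype K] [DecidableEq K] [CharP K 2]
    {F : K → K} {w : K} (hw : w ^ 2 + w + 1 = 0) (hw1 : w ≠ 1) (hq : IsQuadraticMap F)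
    (hF : ∀ x y, F x = F y ↔ x ^ 3 = y ^ 3) (hF0 : F 0 = 0) {r : ℤ}
    (hK : (Fintype.card K : ℤ) = (3 * r + 1) ^ 2) {D : Finset K}
    (hD : D = (Finset.univ.image F).erase 0) {x : K} (hx : x ≠ 0) :
    (((D ×ˢ D).filter fun p => p.1 - p.2 = x).card : ℤ) =
      r * (r + 1) - (r + 1) * (if x ∈ D then 1 else 0) := by
  obtain ⟨ψ, hψ⟩ := exists_primitive_addChar_int K
  obtain ⟨hc, hv⟩ := charSum_mem_of_cube hψ hw hw1 hq hF hF0 hK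
  rw [← hD] at hc hv
  have h := card_mul_card_sub_eq hψ D hv hx
  rw [hc, hK] at h
  have h1 : (3 * r + 1) ^ 2 ≠ 0 := pow_ne_zero _ (by omega)
  refine mul_left_cancel₀ h1 ?_
  linear_combination h

/-! ### Parameters and conclusion -/

/-- The sign makes the power 1 mod 3 for every k, so one r serves both parities. -/
theorem exists_neg_two_pow_eq (k : ℕ) : ∃ r : ℤ, (-2) ^ k = 3 * r + 1 := by
  induction k with
  | zero => exact ⟨0, by norm_num⟩
  | succ k ih =>
    obtain ⟨r, hr⟩ := ih
    exact ⟨-2 * r - 1, by rw [pow_succ, hr]; ring⟩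

theorem mainTheorem4 {K : Type*} [Field K] [Fintype K] (n k : ℕ) (hn : n = 2 * k)
    (hK : Fintype.card K = 2 ^ n) (F G : K → K) (hF : ∀ x, F x = G (x ^ 3)) (hF0 : F 0 = 0)
    (hquad : IsQuadratic 2 F) (hAPN : IsAPN F)
    (hG : Set.InjOn G {y : K | ∃ x : K, x ≠ 0 ∧ x ^ 3 = y}) :
    ∃ κ l m : ℕ,
      IsPartialDifferenceSet (Set.range F \ {0}) (2 ^ n) κ l m ∧
      (κ : ℚ) = (2 ^ n - 1) / 3 ∧
      (Odd k →
        (l : ℚ) = 1 / 9 * (2 ^ k + 4) * (2 ^ k - 2) ∧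
        (m : ℚ) = 1 / 9 * (2 ^ k + 1) * (2 ^ k - 2)) ∧
      (Even k →
        (l : ℚ) = 1 / 9 * (2 ^ k - 4) * (2 ^ k + 2) ∧
        (m : ℚ) = 1 / 9 * (2 ^ k - 1) * (2 ^ k + 2)) := by
  classical
  obtain ⟨r, hr⟩ := exists_neg_two_pow_eq k
  have hcardZ : (Fintype.card K : ℤ) = (3 * r + 1) ^ 2 := by
    rw [← hr, hK, hn, ← pow_mul, mul_comm k 2, pow_mul, pow_mul]
    norm_num
  have : CharP K 2 := by
    refine CharTwo.of_one_ne_zero_of_two_eq_zero one_ne_zero ?_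
    have h := FiniteField.cast_card_eq_zero K
    rw [hK, Nat.cast_pow] at h
    exact_mod_cast pow_eq_zero_iff (M₀ := K) (by rintro rfl; exact absurd h (by simp)) |>.1 h
  obtain ⟨w, hw, hw1⟩ := exists_primitive_cube_root (K := K) (by
    have hpos := Fintype.card_pos (α := K)
    have : (3 : ℤ) ∣ ((Fintype.card K - 1 : ℕ) : ℤ) := by
      rw [Nat.cast_sub hpos, hcardZ]
      exact ⟨3 * r ^ 2 + 2 * r, by push_cast; ring⟩
    exact_mod_cast this)
  have hFw : ∀ x, F (w * x) = F x := fun x => by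
    rw [hF, hF, mul_pow, cube_eq_one_of_sq_add hw, one_mul]
  have hFne : ∀ x, x ≠ 0 → F x ≠ 0 := fun x => hAPN.ne_zero_of_cube hw hw1 hFw hF0
  have hFF : ∀ x y, F x = F y ↔ x ^ 3 = y ^ 3 := by
    intro x y
    refine ⟨fun h => ?_, fun h => by rw [hF, hF, h]⟩
    by_cases hx : x = 0
    · by_cases hy : y = 0
      · rw [hx, hy]
      · exact absurd (by rw [← h, hx, hF0]) (hFne y hy)
    · by_cases hy : y = 0
      · exact absurd (by rw [h, hy, hF0]) (hFne x hx)
      · exact hG ⟨x, hx, rfl⟩ ⟨y, hy, rfl⟩ (by rw [← hF, ← hF, h])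
  obtain ⟨D, hD⟩ : ∃ D : Finset K, D = (Finset.univ.image F).erase 0 := ⟨_, rfl⟩
  have hDset : Set.range F \ {0} = (D : Set K) := by
    ext x
    simp [hD, and_comm]
  have hq := hquad.isQuadraticMap
  have hcard : (D.card : ℤ) = 3 * r ^ 2 + 2 * r := by
    obtain ⟨ψ, hψ⟩ := exists_primitive_addChar_int K
    rw [hD]
    exact (charSum_mem_of_cube hψ hw hw1 hq hFF hF0 hcardZ).1
  have hcount := fun x (hx : x ≠ 0) => card_sub_eq_of_cube hw hw1 hq hFF hF0 hcardZ hD hx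
  have hset : ∀ x : K, x ≠ 0 →
      ({gh : K × K | gh.1 ∈ (D : Set K) ∧ gh.2 ∈ (D : Set K) ∧ gh.1 ≠ gh.2 ∧
        gh.1 - gh.2 = x}.ncard) = ((D ×ˢ D).filter fun p => p.1 - p.2 = x).card := by
    intro x hx
    rw [← Set.ncard_coe_finset]
    congr 1
    ext p
    simp only [Set.mem_ofPred_eq, Finset.coe_filter, Finset.mem_product, Finset.mem_coe]
    refine ⟨fun h => ⟨⟨h.1, h.2.1⟩, h.2.2.2⟩, fun h => ⟨h.1.1, h.1.2, fun he => hx ?_, h.2⟩⟩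
    rw [← h.2, he, sub_self]
  -- The parameters are (r + 1)(r - 1) and r(r + 1); only r = 0, that is |K| = 1, would make the
  -- first negative and spoil `Int.toNat`.
  have hl : 0 ≤ (r + 1) * (r - 1) ∨ r = 0 := by
    by_cases h : r = 0
    · exact Or.inr h
    · left
      rcases lt_or_gt_of_ne h with h | h <;> nlinarith
  have hm : 0 ≤ r * (r + 1) := by
    rcases lt_or_ge r 0 with h | h <;> nlinarith
  have hr0 : r ≠ 0 := by
    rintro rfl
    have := Fintype.one_lt_card (α := K)
    have : (1 : ℤ) < Fintype.card K := by exact_mod_cast this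
    rw [hcardZ] at this
    norm_num at this
  have hl' := hl.resolve_right hr0
  refine ⟨D.card, ((r + 1) * (r - 1)).toNat, (r * (r + 1)).toNat,
    ⟨by rw [Nat.card_eq_fintype_card, hK], by rw [hDset, Set.ncard_coe_finset], by simp,
      ?_, ?_⟩, ?_, ?_, ?_⟩
  · rw [hDset]
    intro x hxD hx
    have h := hcount x hx
    rw [if_pos (Finset.mem_coe.1 hxD)] at h
    rw [hset x hx, ← Nat.cast_inj (R := ℤ), Int.toNat_of_nonneg hl', h]
    ring
  · rw [hDset]
    intro x hxD hx
    have h := hcount x hx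
    rw [if_neg (fun h => hxD (Finset.mem_coe.2 h))] at h
    rw [hset x hx, ← Nat.cast_inj (R := ℤ), Int.toNat_of_nonneg hm, h]
    ring
  · have h1 : (D.card : ℚ) = 3 * (r : ℚ) ^ 2 + 2 * r := by exact_mod_cast hcard
    have h2 : (2 : ℚ) ^ n = (3 * (r : ℚ) + 1) ^ 2 := by
      rw [hK] at hcardZ
      exact_mod_cast hcardZ
    rw [h1, h2]
    ring
  all_goals
    intro hk
    have hlq : ((((r + 1) * (r - 1)).toNat : ℕ) : ℚ) = ((r : ℚ) + 1) * (r - 1) := by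
      exact_mod_cast congrArg (Int.cast : ℤ → ℚ) (Int.toNat_of_nonneg hl')
    have hmq : (((r * (r + 1)).toNat : ℕ) : ℚ) = (r : ℚ) * (r + 1) := by
      exact_mod_cast congrArg (Int.cast : ℤ → ℚ) (Int.toNat_of_nonneg hm)
    rw [hk.neg_pow] at hr
    have hrq := congrArg (Int.cast : ℤ → ℚ) hr
    push_cast at hrq
    rw [hlq, hmq]
  · have h2 : (2 : ℚ) ^ k = -(3 * r + 1) := by linarith
    rw [h2]
    constructor <;> ring
  · rw [hrq]
    constructor <;> ring
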